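/- Let $X$ be a Tychonoff space with exactly one non-isolated point, and let $C_p(X)$ be the space of all continuous functions $X\to\mathbb{R}$ with the topology of pointwise convergence. Then $C_p(X)$ is a $k_{\mathbb{R}}$-space, that is, every function $F:C_p(X)\to\mathbb{R}$ whose restriction to each compact subset of $C_p(X)$ is continuous is itself continuous. If, moreover, the cardinality $|X|$ is not a sequential cardinal, then $C_p(X)$ is an $s_{\mathbb{R}}$-space, that is, every sequentially continuous function $F:C_p(X)\to\mathbb{R}$ is continuous. Here a cardinal $\tau$ is called sequential if there exists a sequentially continuous but discontinuous function $\{0,1\}^\tau\to\mathbb{R}$, where $\{0,1\}$ is discrete and $\{0,1\}^\tau$ carries the product topology. -/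

import Mathlib

universe u

/-- `C_p(X)`: the continuous real-valued functions on `X`, as a subspace of `ℝ^X` with the product
topology, i.e. with the topology of pointwise convergence. -/
abbrev Cp (X : Type u) [TopologicalSpace X] : Type u :=
  {f : X → ℝ // Continuous f}

/-- `f` is `k`-continuous: its restriction to every compact set is continuous. -/
def KContinuous {X : Type u} [TopologicalSpace X] (f : X → ℝ) : Prop :=
  ∀ K : Set X, IsCompact K → ContinuousOn f K

/-- `k_ℝ`-spaces: every `k`-continuous real function is continuous. -/
def IsKRSpace (X : Type u) [TopologicalSpace X] : Prop :=
  ∀ f : X → ℝ, KContinuous f → Continuous f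

/-- `s_ℝ`-spaces: every sequentially continuous real function is continuous. -/
def IsSRSpace (X : Type u) [TopologicalSpace X] : Prop :=
  ∀ f : X → ℝ, SeqContinuous f → Continuous f

/-- A cardinal `κ` is sequential if there is a sequentially continuous but discontinuous function
`2^κ → ℝ`, where `2` is the discrete two-point space and `2^κ` has the product topology. -/
def IsSequentialCardinal (κ : Cardinal.{u}) : Prop :=
  ∃ f : (κ.out → Bool) → ℝ, SeqContinuous f ∧ ¬ Continuous f

open Filter Topology

/-! Any splice of `g` with the translate of `h` agreeing with `g` at `p` is continuous, so `splice`
maps `2^X` continuously into `C_p(X)`. Either hypothesis makes `F` continuous along this map, so `F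
g` is nearly attained at functions equal to `g` only on a finite set. If `F` fails at `h`, a gliding
hump then yields a sequence tending to `h` on which `F` stays away from `F h`. -/

/-- The function equal to `g` where `u` is true and to `h + (g p - h p)` elsewhere is continuous
when `p` is the only non-isolated point. -/
theorem continuous_splice {X : Type u} [TopologicalSpace X] {p : X}
    (hp : ∀ x, x ≠ p → IsOpen ({x} : Set X)) (g h : Cp X) (u : X → Bool) :
    Continuous fun x => if u x = true then g.1 x else h.1 x + (g.1 p - h.1 p) := by
  rw [continuous_iff_continuousAt]
  intro x
  by_cases hx : x = p
  · subst hx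
    have hg : Tendsto g.1 (𝓝 x) (𝓝 (g.1 x)) := g.2.tendsto x
    have hh : Tendsto (fun y => h.1 y + (g.1 x - h.1 x)) (𝓝 x) (𝓝 (g.1 x)) := by
      simpa using (h.2.tendsto x).add_const (g.1 x - h.1 x)
    have hval : (if u x = true then g.1 x else h.1 x + (g.1 x - h.1 x)) = g.1 x := by
      split_ifs <;> ring
    rw [ContinuousAt, hval]
    exact hg.if' hh
  · rw [ContinuousAt, isOpen_singleton_iff_nhds_eq_pure _ |>.1 (hp x hx)]
    exact tendsto_pure_left.2 fun s hs => mem_of_mem_nhds hs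

/-- The continuous image of `2^X` in `C_p(X)` interpolating between a translate of `h` and `g`. -/
noncomputable def splice {X : Type u} [TopologicalSpace X] {p : X}
    (hp : ∀ x, x ≠ p → IsOpen ({x} : Set X)) (g h : Cp X) (u : X → Bool) : Cp X :=
  ⟨_, continuous_splice hp g h u⟩

theorem continuous_splice_left {X : Type u} [TopologicalSpace X] {p : X}
    (hp : ∀ x, x ≠ p → IsOpen ({x} : Set X)) (g h : Cp X) : Continuous (splice hp g h) := by
  refine Continuous.subtype_mk (continuous_pi fun x => ?_) _
  exact (continuous_of_discreteTopology
    (f := fun b : Bool => if b = true then g.1 x else h.1 x + (g.1 p - h.1 p))).comp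
    (continuous_apply x)

/-- A function that is continuous along every splice can be tested on a finite modification. -/
theorem exists_finset_splice_dist_lt {X : Type u} [TopologicalSpace X] {p : X}
    (hp : ∀ x, x ≠ p → IsOpen ({x} : Set X)) (F : Cp X → ℝ) (g h : Cp X)
    (hF : Continuous fun u => F (splice hp g h u)) (A : Finset X) {ε : ℝ} (hε : 0 < ε) :
    ∃ B : Finset X, A ⊆ B ∧ ∃ g' : Cp X, (∀ x ∈ B, g'.1 x = g.1 x) ∧
      (∀ x ∉ B, g'.1 x = h.1 x + (g.1 p - h.1 p)) ∧ dist (F g') (F g) < ε := by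
  classical
  have hlim : Tendsto (fun B : Finset X => fun x => decide (x ∈ B)) atTop
      (𝓝 (fun _ : X => true)) := by
    refine tendsto_pi_nhds.2 fun x => tendsto_const_nhds.congr' ?_
    filter_upwards [eventually_ge_atTop {x}] with B hB
    exact (decide_eq_true (hB (Finset.mem_singleton_self x))).symm
  have htrue : splice hp g h (fun _ => true) = g := Subtype.ext (funext fun x => by simp [splice])
  have hFlim := (hF.tendsto _).comp hlim
  rw [htrue] at hFlim
  obtain ⟨B, hB, hAB⟩ :=
    ((hFlim.eventually (Metric.ball_mem_nhds _ hε)).and (eventually_ge_atTop A)).exists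
  refine ⟨B, hAB, splice hp g h fun x => decide (x ∈ B), fun x hx => ?_, fun x hx => ?_, hB⟩ <;>
    simp [splice, hx]

/-- In a failure of continuity at `h`, a witness can be chosen close to `h` both on a prescribed
finite set and off a larger finite set. -/
theorem exists_close_of_not_continuousAt {X : Type u} [TopologicalSpace X] {p : X}
    (hp : ∀ x, x ≠ p → IsOpen ({x} : Set X)) (F : Cp X → ℝ)
    (hF : ∀ g h, Continuous fun u => F (splice hp g h u)) {h : Cp X} {ε : ℝ} (hε : 0 < ε)
    (hbad : ∃ᶠ g in 𝓝 h, ε ≤ dist (F g) (F h)) (A : Finset X) {δ : ℝ} (hδ : 0 < δ) :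
    ∃ (g : Cp X) (B : Finset X), A ⊆ B ∧ (∀ x, x ∈ A ∨ x ∉ B → dist (g.1 x) (h.1 x) < δ) ∧
      ε / 2 ≤ dist (F g) (F h) := by
  classical
  -- Including `p` makes the translation constant `g p - h p` smaller than `δ`.
  have hnear : ∀ᶠ g : Cp X in 𝓝 h, ∀ x ∈ insert p A, dist (g.1 x) (h.1 x) < δ := by
    rw [Filter.eventually_all_finset]
    intro x _
    exact (((continuous_apply x).comp continuous_subtype_val).tendsto h).eventually
      (Metric.ball_mem_nhds _ hδ)
  obtain ⟨g, hg, hclose⟩ := (hbad.and_eventually hnear).exists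
  obtain ⟨B, hAB, g', hon, hoff, hFg⟩ :=
    exists_finset_splice_dist_lt hp F g h (hF g h) A (half_pos hε)
  refine ⟨g', B, hAB, ?_, ?_⟩
  · rintro x (hx | hx)
    · rw [hon x (hAB hx)]
      exact hclose x (Finset.mem_insert_of_mem hx)
    · have := hclose p (Finset.mem_insert_self p A)
      rw [hoff x hx]
      simpa [Real.dist_eq] using this
  · have := dist_triangle_left (F g) (F h) (F g')
    linarith

theorem continuous_of_seqContinuous_of_continuous_splice {X : Type u} [TopologicalSpace X] {p : X}
    (hp : ∀ x, x ≠ p → IsOpen ({x} : Set X)) (F : Cp X → ℝ) (hseq : SeqContinuous F)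
    (hF : ∀ g h, Continuous fun u => F (splice hp g h u)) : Continuous F := by
  rw [continuous_iff_continuousAt]
  intro h
  by_contra hcont
  obtain ⟨ε, hε, hbad⟩ : ∃ ε > 0, ∃ᶠ g in 𝓝 h, ε ≤ dist (F g) (F h) := by
    rw [ContinuousAt, Metric.tendsto_nhds] at hcont
    push Not at hcont
    simpa only [not_eventually, not_lt] using hcont
  choose G B hAB hclose hfar using fun (A : Finset X) (n : ℕ) =>
    exists_close_of_not_continuousAt hp F hF hε hbad A (Nat.one_div_pos_of_nat (α := ℝ) (n := n))
  -- The `n`-th witness can be far from `h` only on `A (n + 1) \ A n`; these sets are disjoint, so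
  -- each point is affected at most once.
  let A : ℕ → Finset X := fun n => Nat.rec ∅ (fun k S => B S k) n
  have hA : Monotone A := monotone_nat_of_le_succ fun n => hAB (A n) n
  have hlim : Tendsto (fun n => G (A n) n) atTop (𝓝 h) := by
    rw [tendsto_subtype_rng, tendsto_pi_nhds]
    intro x
    rw [tendsto_iff_dist_tendsto_zero]
    refine squeeze_zero' (Eventually.of_forall fun _ => dist_nonneg) ?_
      tendsto_one_div_add_atTop_nhds_zero_nat
    rcases em (∃ m, x ∈ A m) with ⟨m, hm⟩ | hx
    · filter_upwards [eventually_ge_atTop m] with n hn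
      exact (hclose (A n) n x (Or.inl (hA hn hm))).le
    · push Not at hx
      exact Eventually.of_forall fun n => (hclose (A n) n x (Or.inr (hx (n + 1)))).le
  obtain ⟨n, hn⟩ := ((hseq hlim).eventually (Metric.ball_mem_nhds _ (half_pos hε))).exists
  exact (hfar (A n) n).not_gt hn

theorem KContinuous.comp_continuous {Y Z : Type u} [TopologicalSpace Y] [TopologicalSpace Z]
    [CompactSpace Y] {F : Z → ℝ} (hF : KContinuous F) {φ : Y → Z} (hφ : Continuous φ) :
    Continuous fun y => F (φ y) :=
  (hF _ (isCompact_range hφ)).comp_continuous hφ Set.mem_range_self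

/-- A convergent sequence together with its limit is compact. -/
theorem KContinuous.seqContinuous {Z : Type u} [TopologicalSpace Z] {F : Z → ℝ}
    (hF : KContinuous F) : SeqContinuous F := by
  intro s z hs
  refine ((hF _ hs.isCompact_insert_range) z (Set.mem_insert _ _)).tendsto.comp
    (tendsto_nhdsWithin_iff.2 ⟨hs, Eventually.of_forall fun n => ?_⟩)
  exact Set.mem_insert_of_mem _ (Set.mem_range_self n)

theorem continuous_of_not_isSequentialCardinal {X : Type u}
    (hX : ¬ IsSequentialCardinal (Cardinal.mk X)) {f : (X → Bool) → ℝ} (hf : SeqContinuous f) :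
    Continuous f := by
  let e : (Cardinal.mk X).out ≃ X := Cardinal.outMkEquiv
  let E : ((Cardinal.mk X).out → Bool) ≃ₜ (X → Bool) :=
    Homeomorph.piCongrLeft (Y := fun _ => Bool) e
  have hc : Continuous (f ∘ E) := by
    by_contra hc
    exact hX ⟨f ∘ E, fun _ _ hs => hf (E.continuous.seqContinuous hs), hc⟩
  exact E.comp_continuous_iff'.1 hc

theorem theorem10p5 (X : Type u) [TopologicalSpace X] [T35Space X]
    (hX : ∃! x : X, ¬ IsOpen ({x} : Set X)) :
    IsKRSpace (Cp X) ∧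
      (¬ IsSequentialCardinal (Cardinal.mk X) → IsSRSpace (Cp X)) := by
  obtain ⟨p, -, huniq⟩ := hX
  have hp : ∀ x, x ≠ p → IsOpen ({x} : Set X) := fun x hx => by
    by_contra h
    exact hx (huniq x h)
  refine ⟨fun F hF => ?_, fun hcard F hF => ?_⟩
  · exact continuous_of_seqContinuous_of_continuous_splice hp F hF.seqContinuous fun g h =>
      hF.comp_continuous (continuous_splice_left hp g h)
  · exact continuous_of_seqContinuous_of_continuous_splice hp F hF fun g h =>
      continuous_of_not_isSequentialCardinal hcard
        fun _ _ hs => hF ((continuous_splice_left hp g h).seqContinuous hs)
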